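/- Let $\mathcal I$ be a nonempty countable (finite or infinite) set and let $M=(m_{ij})_{i,j\in\mathcal I}$ be an irreducible 0-1 matrix (for all $i,j$ there is a path of positive length from $i$ to $j$ in the graph of $M$) all of whose column sums $c_j=\sum_i m_{ij}$ are finite. Let $\Sigma_M=\{x\in\mathcal I^{\mathbb N} : m_{x_nx_{n+1}}=1 \text{ for all } n\ge 0\}$ be the one-sided Markov shift, with the Borel $\sigma$-algebra of the product topology ($\mathcal I$ discrete), let $\sigma:\Sigma_M\to\Sigma_M$ be the shift map, and let $[i]=\{x\in\Sigma_M : x_0=i\}$. A $\sigma$-invariant probability measure $\mu$ on $\Sigma_M$ is called fair if for each measurable set $B$ which for every $i$ is contained either in $\sigma([i])$ or in its complement, $$\mu([i]\cap\sigma^{-1}(B))=\frac{\mu(B)}{c(B)}\quad\text{for all } i\in p(B),\qquad p(B)=\{i : B\subset\sigma([i])\},\quad c(B)=\#p(B).$$ Let $Q$ be the stochastic matrix with entries $q_{ji}=m_{ij}/c_j$. It is called positive recurrent, null recurrent, or transient according to whether, for the Markov chain with transition matrix $Q$, every state is recurrent with finite mean return time, every state is recurrent with infinite mean return time, or every state has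 return probability less than $1$. (1) If $Q$ is positive recurrent, then there is exactly one probability vector $\pi$ with $\pi Q=\pi$; all its entries are positive; and with the stochastic matrix $P$ defined by $\pi_i p_{ij}=\pi_j q_{ji}$, the Markov measure $\mu=\mathrm{Markov}(\pi,P)$, i.e. the probability measure with $\mu(\{x\in\Sigma_M : x_0=w_0,\dots,x_n=w_n\})=\pi_{w_0}p_{w_0w_1}\cdots p_{w_{n-1}w_n}$ for all $n\ge 0$ and $w_0,\dots,w_n\in\mathcal I$, exists on $\Sigma_M$, is ergodic with respect to $\sigma$, is fair, and is the only fair measure on $\Sigma_M$. (2) If $Q$ is null recurrent or transient, then there is no fair measure on $\Sigma_M$. -/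

import Mathlib

open MeasureTheory
open scoped ENNReal

noncomputable section

/-! ### Fair measures -/

/-- `B` is contained in a single element of the common refinement of the partitions
`{f(Aᵢ), X ∖ f(Aᵢ)}`. -/
def SubordinateToImages {X ι : Type*} (f : X → X) (A : ι → Set X) (B : Set X) : Prop :=
  ∀ i, B ⊆ f '' A i ∨ B ⊆ (f '' A i)ᶜ

/-- The set `p(B)` of the inverse branches of `f` that are defined on `B`. -/
def branches {X ι : Type*} (f : X → X) (A : ι → Set X) (B : Set X) : Set ι :=
  {i | B ⊆ f '' A i}

/-- `μ` is a fair measure for `f` with respect to the countable partition `A` of the space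
(into measurable pieces on each of which `f` is a measurable isomorphism onto its image): an
invariant probability measure with `μ(Aᵢ ∩ f⁻¹(B)) = μ(B) / c(B)` for all `i ∈ p(B)`, where
`c(B)` is the cardinality of `p(B)`, whenever `B` is measurable and subordinate to the images. -/
structure IsFair {X ι : Type*} [MeasurableSpace X] (f : X → X) (A : ι → Set X)
    (μ : Measure X) : Prop where
  isProbabilityMeasure : IsProbabilityMeasure μ
  measurePreserving : MeasurePreserving f μ μ
  fair : ∀ B : Set X, MeasurableSet B → SubordinateToImages f A B →
    ∀ i ∈ branches f A B, μ (A i ∩ f ⁻¹' B) = μ B / ((branches f A B).encard : ℝ≥0∞)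

/-! ### Countable state Markov shifts -/

/-- The one-sided shift space `Σ_M` of a 0-1 matrix `M`. -/
def markovShift {I : Type*} (M : Matrix I I ℤ) : Set (ℕ → I) :=
  {x | ∀ n, M (x n) (x (n + 1)) = 1}

/-- The shift map `σ` on `Σ_M`. -/
def shiftMap {I : Type*} (M : Matrix I I ℤ) (x : markovShift M) : markovShift M :=
  ⟨fun n => x.1 (n + 1), fun n => x.2 (n + 1)⟩

/-- The cylinder `[w₀ w₁ ⋯ wₙ]` in `Σ_M`. -/
def cylinderSet {I : Type*} (M : Matrix I I ℤ) (n : ℕ) (w : ℕ → I) : Set (markovShift M) :=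
  {x | ∀ k ≤ n, x.1 k = w k}

/-- The partition of `Σ_M` into the cylinders `[i]` of length one. -/
def cylinderPartition {I : Type*} (M : Matrix I I ℤ) (i : I) : Set (markovShift M) :=
  {x | x.1 0 = i}

/-- The column sum `c_j = ∑ᵢ m_ij`, possibly infinite. -/
def columnSum {I : Type*} (M : Matrix I I ℤ) (j : I) : ℝ≥0∞ :=
  ∑' i, ((M i j).toNat : ℝ≥0∞)

/-- The matrix `Q` with entries `q_ji = m_ij / c_j`. -/
def backwardMatrix {I : Type*} (M : Matrix I I ℤ) : Matrix I I ℝ≥0∞ :=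
  fun j i => ((M i j).toNat : ℝ≥0∞) / columnSum M j

/-! ### Markov chains with countably many states -/

/-- The probability that a Markov chain with transition probabilities `Q`, started at `i`,
visits `j` at time `n ≥ 1` for the first time after time `0`. -/
def firstPassage {I : Type*} (Q : Matrix I I ℝ≥0∞) (j : I) : ℕ → I → ℝ≥0∞
  | 0, _ => 0
  | 1, i => Q i j
  | n + 2, i => ∑' k : {k : I // k ≠ j}, Q i k * firstPassage Q j (n + 1) k

/-- The probability that the chain started at `i` returns to `i`. -/
def returnProbability {I : Type*} (Q : Matrix I I ℝ≥0∞) (i : I) : ℝ≥0∞ :=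
  ∑' n : ℕ, firstPassage Q i n i

/-- The expected time of the first return to `i` (for a chain that returns almost surely). -/
def meanReturnTime {I : Type*} (Q : Matrix I I ℝ≥0∞) (i : I) : ℝ≥0∞ :=
  ∑' n : ℕ, (n : ℝ≥0∞) * firstPassage Q i n i

def IsPositiveRecurrent {I : Type*} (Q : Matrix I I ℝ≥0∞) : Prop :=
  ∀ i, returnProbability Q i = 1 ∧ meanReturnTime Q i < ∞

def IsNullRecurrent {I : Type*} (Q : Matrix I I ℝ≥0∞) : Prop :=
  ∀ i, returnProbability Q i = 1 ∧ meanReturnTime Q i = ∞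

def IsTransient {I : Type*} (Q : Matrix I I ℝ≥0∞) : Prop :=
  ∀ i, returnProbability Q i < 1

/-- `π` is a probability vector with `π Q = π`. -/
structure IsStationaryDistribution {I : Type*} (Q : Matrix I I ℝ≥0∞) (π : I → ℝ≥0∞) : Prop where
  sum_eq_one : ∑' i, π i = 1
  stationary : ∀ i, ∑' j, π j * Q j i = π i

/-- The matrix `P` with `π_i p_ij = π_j q_ji`. -/
def timeReversal {I : Type*} (Q : Matrix I I ℝ≥0∞) (π : I → ℝ≥0∞) : Matrix I I ℝ≥0∞ :=
  fun i j => π j * Q j i / π i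

/-- `μ` is the Markov measure `Markov(π, P)` on `Σ_M`: `π` is a probability vector, `P` is a
stochastic matrix, and `μ [w₀ ⋯ wₙ] = π(w₀) P(w₀, w₁) ⋯ P(wₙ₋₁, wₙ)` for every cylinder. -/
structure IsMarkovMeasure {I : Type*} [MeasurableSpace I] (M : Matrix I I ℤ)
    (π : I → ℝ≥0∞) (P : Matrix I I ℝ≥0∞) (μ : Measure (markovShift M)) : Prop where
  sum_eq_one : ∑' i, π i = 1
  stochastic : ∀ i, ∑' j, P i j = 1
  isProbabilityMeasure : IsProbabilityMeasure μ
  cylinder : ∀ (n : ℕ) (w : ℕ → I),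
    μ (cylinderSet M n w) = π (w 0) * ∏ k ∈ Finset.range n, P (w k) (w (k + 1))

end

/-!
A fair measure is a measure on `Σ_M` for which the Markov chain that follows the points of `Σ_M`
backwards has transition matrix `Q`: a fair measure `μ` satisfies
`μ([i] ∩ σ⁻¹(B)) = ∑ⱼ q_ji μ([j] ∩ B)` for all measurable `B`, and conversely this identity
(`HasBackwardTransitions`) makes a probability measure invariant and fair
(`IsFair.hasBackwardTransitions`, `HasBackwardTransitions.isFair`). With `B` the whole space it
says that `j ↦ μ[j]` is a stationary distribution of `Q`; iterated along a cylinder it shows that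
this distribution determines `μ` (`HasBackwardTransitions.ext`).

The theorem thus reduces to facts about the irreducible stochastic matrix `Q`. If it has a
stationary distribution `π`, then `π` is positive, and Kac's inequality
`π_j ∑ₙ P_j(T_j > n) ≤ 1` shows that `Q` is positive recurrent
(`IsStationaryDistribution.recurrent`); this excludes fair measures in the null recurrent and
transient cases. If `Q` is positive recurrent, the expected numbers of visits between two visits to
a fixed state yield a stationary distribution (`exists_isStationaryDistribution`), and
irreducibility makes it unique (`IsStationaryDistribution.unique`).

Given `π`, the Ionescu-Tulcea theorem provides the Markov measure of the time-reversed matrix `P`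
(`exists_isMarkovMeasure`). Reversing time again shows that its backward transitions are those of
`Q`, so it is fair. Since the identity above survives conditioning on an invariant set, uniqueness
of the fair measure implies its ergodicity (`HasBackwardTransitions.preErgodic`).
-/

/-! ### Return times of countable state Markov chains -/

/-- The probability that a Markov chain with transition probabilities `Q`, started at `i`, does
not visit `j` at any of the times `1, …, n`. -/
noncomputable def avoidProbability {I : Type*} (Q : Matrix I I ℝ≥0∞) (j : I) : ℕ → I → ℝ≥0∞
  | 0, _ => 1
  | n + 1, i => ∑' k : {k : I // k ≠ j}, Q i k * avoidProbability Q j n k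

theorem ENNReal.tsum_eq_add_tsum_ne {I : Type*} (f : I → ℝ≥0∞) (j : I) :
    ∑' k, f k = f j + ∑' k : {k : I // k ≠ j}, f k := by
  classical
  have h : ∑' k : {k : I // k ≠ j}, f k = ∑' k, if k = j then 0 else f k := by
    refine (tsum_subtype {k : I | k ≠ j} f).trans ?_
    refine tsum_congr fun k => ?_
    by_cases hk : k = j <;> simp [hk]
  rw [h, ENNReal.tsum_eq_add_tsum_ite j]

theorem ENNReal.tsum_nat_mul_eq_tsum_tsum (f : ℕ → ℝ≥0∞) :
    ∑' n : ℕ, (n : ℝ≥0∞) * f n = ∑' n : ℕ, ∑' m : ℕ, f (m + (n + 1)) := by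
  have h1 : ∀ n : ℕ, (n : ℝ≥0∞) * f n = ∑' k : ℕ, if k < n then f n else 0 := by
    intro n
    rw [tsum_eq_sum (s := Finset.range n)]
    · rw [Finset.sum_congr rfl (g := fun _ => f n)]
      · simp
      · intro k hk
        simp [Finset.mem_range.1 hk]
    · intro k hk
      exact if_neg (by simpa using hk)
  rw [tsum_congr h1, ENNReal.tsum_comm]
  refine tsum_congr fun k => ?_
  rw [← ENNReal.summable.sum_add_tsum_nat_add' (k := k + 1), Finset.sum_eq_zero, zero_add]
  · exact tsum_congr fun m => if_pos (by omega)
  · intro n hn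
    have := Finset.mem_range.1 hn
    exact if_neg (by omega)

section Chain

variable {I : Type*} {Q : Matrix I I ℝ≥0∞}

theorem firstPassage_add_avoidProbability (hQ : ∀ i, ∑' j, Q i j = 1) (j : I) (n : ℕ) (i : I) :
    firstPassage Q j (n + 1) i + avoidProbability Q j (n + 1) i = avoidProbability Q j n i := by
  induction n generalizing i with
  | zero =>
    have h := ENNReal.tsum_eq_add_tsum_ne (Q i) j
    rw [hQ] at h
    simp only [firstPassage, avoidProbability, mul_one]
    exact h.symm
  | succ n ih =>
    rw [firstPassage, avoidProbability, ← ENNReal.tsum_add, avoidProbability]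
    exact tsum_congr fun k => by rw [← mul_add, ih]

theorem sum_firstPassage_add_avoidProbability (hQ : ∀ i, ∑' j, Q i j = 1) (j : I) (n : ℕ)
    (i : I) :
    ∑ m ∈ Finset.range (n + 1), firstPassage Q j m i + avoidProbability Q j n i = 1 := by
  induction n with
  | zero => simp [firstPassage, avoidProbability]
  | succ n ih =>
    rw [Finset.sum_range_succ, add_assoc, firstPassage_add_avoidProbability hQ, ih]

/-- For a recurrent state, the mean return time is the sum of the tails of the distribution of
the return time. -/
theorem meanReturnTime_eq_tsum_avoidProbability (hQ : ∀ i, ∑' j, Q i j = 1) (j : I)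
    (hj : returnProbability Q j = 1) :
    meanReturnTime Q j = ∑' n, avoidProbability Q j n j := by
  rw [meanReturnTime, ENNReal.tsum_nat_mul_eq_tsum_tsum]
  refine tsum_congr fun n => ?_
  have h1 := sum_firstPassage_add_avoidProbability hQ j n j
  have h2 : ∑ m ∈ Finset.range (n + 1), firstPassage Q j m j
      + ∑' m, firstPassage Q j (m + (n + 1)) j = 1 := by
    rw [ENNReal.summable.sum_add_tsum_nat_add' (f := fun m => firstPassage Q j m j)]
    exact hj
  refine (ENNReal.add_right_inj ?_).1 (h2.trans h1.symm)
  exact ne_top_of_le_ne_top ENNReal.one_ne_top (h1 ▸ le_self_add)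

/-- If the return time has summable tails, the state is recurrent. -/
theorem returnProbability_eq_one_of_tsum_avoidProbability_ne_top (hQ : ∀ i, ∑' j, Q i j = 1)
    (j : I) (hj : ∑' n, avoidProbability Q j n j ≠ ∞) : returnProbability Q j = 1 := by
  have h0 := ENNReal.tendsto_atTop_zero_of_tsum_ne_top hj
  have h1 := (ENNReal.tendsto_nat_tsum fun m => firstPassage Q j m j).comp
    (Filter.tendsto_add_atTop_nat 1)
  have h2 := h1.add h0
  simp only [Function.comp_apply, add_zero] at h2
  refine tendsto_nhds_unique h2 ?_
  simp_rw [sum_firstPassage_add_avoidProbability hQ]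
  exact tendsto_const_nhds

/-- The inequality in Kac's formula: under a stationary distribution `π`, the time-`n` terms
`π j * P_j(T_j > n)` are the probabilities of the disjoint events that the last visit to `j`
up to a given time took place `n` steps before that time. -/
theorem IsStationaryDistribution.mul_tsum_avoidProbability_le_one {π : I → ℝ≥0∞}
    (hπ : IsStationaryDistribution Q π) (j : I) :
    π j * ∑' n, avoidProbability Q j n j ≤ 1 := by
  have hstep : ∀ n, π j * avoidProbability Q j n j + ∑' i, π i * avoidProbability Q j (n + 1) i
      = ∑' i, π i * avoidProbability Q j n i := by
    intro n
    rw [ENNReal.tsum_eq_add_tsum_ne (fun i => π i * avoidProbability Q j n i) j]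
    congr 1
    simp_rw [avoidProbability, ← ENNReal.tsum_mul_left]
    rw [ENNReal.tsum_comm]
    refine tsum_congr fun k => ?_
    rw [← hπ.stationary k, ← ENNReal.tsum_mul_right]
    exact tsum_congr fun i => (mul_assoc _ _ _).symm
  have hsum : ∀ N, ∑ n ∈ Finset.range N, π j * avoidProbability Q j n j
      + ∑' i, π i * avoidProbability Q j N i = 1 := by
    intro N
    induction N with
    | zero => simp [avoidProbability, hπ.sum_eq_one]
    | succ N ih => rw [Finset.sum_range_succ, add_assoc, hstep, ih]
  rw [← ENNReal.tsum_mul_left]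
  exact ENNReal.tsum_le_of_sum_range_le fun N => hsum N ▸ le_self_add

/-- A state that is charged by a stationary distribution is recurrent with finite mean return
time. -/
theorem IsStationaryDistribution.recurrent {π : I → ℝ≥0∞} (hQ : ∀ i, ∑' j, Q i j = 1)
    (hπ : IsStationaryDistribution Q π) {j : I} (hj : π j ≠ 0) :
    returnProbability Q j = 1 ∧ meanReturnTime Q j < ∞ := by
  have hfin : ∑' n, avoidProbability Q j n j ≠ ∞ := by
    intro h
    have := hπ.mul_tsum_avoidProbability_le_one j
    rw [h, ENNReal.mul_top hj] at this
    exact absurd this (by simp)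
  have hret := returnProbability_eq_one_of_tsum_avoidProbability_ne_top hQ j hfin
  exact ⟨hret, by
    rw [meanReturnTime_eq_tsum_avoidProbability hQ j hret]; exact hfin.lt_top⟩

/-! ### Stationary distributions -/

open Classical in
/-- The probability that a Markov chain with transition probabilities `Q`, started at `j`, is at
`i` at time `n` and has not returned to `j` at any of the times `1, …, n`. -/
noncomputable def tabooProbability (Q : Matrix I I ℝ≥0∞) (j : I) : ℕ → I → ℝ≥0∞
  | 0, i => if i = j then 1 else 0
  | n + 1, i => if i = j then 0 else ∑' k, tabooProbability Q j n k * Q k i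

/-- The Markov property for the chain killed at its return to `j`: for functions `h m` that are
obtained from one another by one step of the killed chain, `n` steps from `j` lead from `h m` to
`h (n + m)`. -/
theorem tsum_tabooProbability_mul (j : I) (h : ℕ → I → ℝ≥0∞)
    (hh : ∀ m i, h (m + 1) i = ∑' k : {k : I // k ≠ j}, Q i k * h m k) (n m : ℕ) :
    ∑' k, tabooProbability Q j n k * h m k = h (n + m) j := by
  induction n generalizing m with
  | zero =>
    rw [tsum_eq_single j fun k hk => by simp [tabooProbability, hk]]
    simp [tabooProbability]
  | succ n ih =>
    rw [show n + 1 + m = n + (m + 1) by omega, ← ih (m + 1),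
      ENNReal.tsum_eq_add_tsum_ne _ j]
    simp_rw [hh, ← ENNReal.tsum_mul_left]
    rw [ENNReal.tsum_comm (α := I)]
    simp only [tabooProbability, if_true, zero_mul, zero_add]
    refine tsum_congr fun k => ?_
    rw [if_neg k.2, ← ENNReal.tsum_mul_right]
    exact tsum_congr fun i => mul_assoc _ _ _

/-- The expected numbers of visits between two visits to a positive recurrent state `j`, divided
by the mean return time, form a stationary distribution. -/
theorem exists_isStationaryDistribution (hQ : ∀ i, ∑' j, Q i j = 1) (j : I)
    (hret : returnProbability Q j = 1) (hmean : meanReturnTime Q j < ∞) :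
    ∃ π, IsStationaryDistribution Q π := by
  have havoid : ∀ n, ∑' k, tabooProbability Q j n k = avoidProbability Q j n j := by
    intro n
    simpa [avoidProbability] using
      tsum_tabooProbability_mul (Q := Q) j (avoidProbability Q j) (fun m i => rfl) n 0
  have hfirst : ∀ n, ∑' k, tabooProbability Q j n k * Q k j = firstPassage Q j (n + 1) j :=
    fun n => tsum_tabooProbability_mul (Q := Q) j (fun m => firstPassage Q j (m + 1))
      (fun m i => rfl) n 0
  have hγsum : ∑' i, ∑' n, tabooProbability Q j n i = meanReturnTime Q j := by
    rw [ENNReal.tsum_comm, meanReturnTime_eq_tsum_avoidProbability hQ j hret]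
    exact tsum_congr havoid
  have hγ : ∀ i, ∑' k, (∑' n, tabooProbability Q j n k) * Q k i
      = ∑' n, tabooProbability Q j n i := by
    intro i
    simp_rw [← ENNReal.tsum_mul_right]
    rw [ENNReal.tsum_comm, tsum_eq_zero_add' (f := fun n => tabooProbability Q j n i)
      ENNReal.summable]
    by_cases hi : i = j
    · subst hi
      rw [tsum_congr hfirst]
      rw [returnProbability, tsum_eq_zero_add' ENNReal.summable] at hret
      simpa [tabooProbability, firstPassage] using hret
    · simp [tabooProbability, hi]
  have h0 : meanReturnTime Q j ≠ 0 := by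
    rw [meanReturnTime_eq_tsum_avoidProbability hQ j hret]
    intro h
    simpa [avoidProbability] using ENNReal.tsum_eq_zero.1 h 0
  refine ⟨fun i => (∑' n, tabooProbability Q j n i) / meanReturnTime Q j, ?_, fun i => ?_⟩
  · simp_rw [div_eq_mul_inv]
    rw [ENNReal.tsum_mul_right, hγsum, ENNReal.mul_inv_cancel h0 hmean.ne]
  · simp_rw [div_eq_mul_inv, mul_right_comm _ (meanReturnTime Q j)⁻¹]
    rw [ENNReal.tsum_mul_right, hγ]

/-- The support of an invariant vector is closed under the transitions of the chain. -/
theorem ne_zero_of_invariant {ρ : I → ℝ≥0∞} (hρ : ∀ i, ∑' j, ρ j * Q j i = ρ i)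
    (hirr : ∀ i k, Relation.ReflTransGen (fun a b => Q a b ≠ 0) i k) {i : I} (hi : ρ i ≠ 0)
    (k : I) : ρ k ≠ 0 := by
  induction hirr i k with
  | refl => exact hi
  | @tail b c _ hbc ih =>
    rw [← hρ c]
    exact fun h => mul_ne_zero ih hbc (ENNReal.tsum_eq_zero.1 h b)

theorem IsStationaryDistribution.ne_zero {π : I → ℝ≥0∞} (hπ : IsStationaryDistribution Q π)
    (hirr : ∀ i k, Relation.ReflTransGen (fun a b => Q a b ≠ 0) i k) (k : I) : π k ≠ 0 := by
  obtain ⟨i, hi⟩ : ∃ i, π i ≠ 0 := by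
    by_contra! h
    simpa [h] using hπ.sum_eq_one
  exact ne_zero_of_invariant hπ.stationary hirr hi k

theorem IsStationaryDistribution.ne_top {π : I → ℝ≥0∞} (hπ : IsStationaryDistribution Q π)
    (k : I) : π k ≠ ∞ :=
  ne_top_of_le_ne_top ENNReal.one_ne_top (hπ.sum_eq_one ▸ ENNReal.le_tsum k)

/-- An irreducible chain has at most one stationary distribution `π`: the minimum of `π` and `π'`
is invariant, since it is subinvariant and has finite mass. Hence `π - min π π'` and
`π' - min π π'` are invariant; their supports are disjoint, so one of them vanishes. -/
theorem IsStationaryDistribution.unique {π π' : I → ℝ≥0∞} (hQ : ∀ i, ∑' j, Q i j = 1)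
    (hirr : ∀ i k, Relation.ReflTransGen (fun a b => Q a b ≠ 0) i k)
    (hπ : IsStationaryDistribution Q π) (hπ' : IsStationaryDistribution Q π') : π' = π := by
  set ρ : I → ℝ≥0∞ := fun i => min (π i) (π' i) with hρ_def
  have hρsum : ∑' i, ρ i ≠ ∞ := ne_top_of_le_ne_top ENNReal.one_ne_top
    (hπ.sum_eq_one ▸ ENNReal.tsum_le_tsum fun i => min_le_left _ _)
  have hρtop : ∀ i, ρ i ≠ ∞ := fun i => ne_top_of_le_ne_top hρsum (ENNReal.le_tsum i)
  have hle : ∀ i, ∑' j, ρ j * Q j i ≤ ρ i := fun i => le_min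
    (hπ.stationary i ▸ ENNReal.tsum_le_tsum fun j => mul_le_mul_left (min_le_left _ _) _)
    (hπ'.stationary i ▸ ENNReal.tsum_le_tsum fun j => mul_le_mul_left (min_le_right _ _) _)
  have hmass : ∑' i, ∑' j, ρ j * Q j i = ∑' i, ρ i := by
    rw [ENNReal.tsum_comm]
    exact tsum_congr fun j => by rw [ENNReal.tsum_mul_left, hQ, mul_one]
  have hρ : ∀ i, ∑' j, ρ j * Q j i = ρ i := by
    intro i
    refine le_antisymm (hle i) (not_lt.1 fun hlt => ?_)
    exact (ENNReal.tsum_lt_tsum (hmass ▸ hρsum) hle hlt).ne hmass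
  have hdiff : ∀ τ : I → ℝ≥0∞, (∀ i, ∑' j, τ j * Q j i = τ i) → (∀ i, ρ i ≤ τ i) →
      ∀ i, ∑' j, (τ j - ρ j) * Q j i = τ i - ρ i := by
    intro τ hτ hρτ i
    refine ENNReal.eq_sub_of_add_eq (hρtop i) ?_
    refine (congrArg (_ + ·) (hρ i).symm).trans ?_
    rw [← ENNReal.tsum_add, ← hτ i]
    exact tsum_congr fun j => by rw [← add_mul, tsub_add_cancel_of_le (hρτ j)]
  -- A probability vector that is dominated by another one is equal to it.
  have hdom : ∀ τ τ' : I → ℝ≥0∞, ∑' i, τ i = 1 → ∑' i, τ' i = 1 → (∀ i, τ i ≤ τ' i) →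
      τ = τ' := by
    intro τ τ' h1 h2 h
    funext i
    refine le_antisymm (h i) (not_lt.1 fun hlt => ?_)
    exact (ENNReal.tsum_lt_tsum (h1 ▸ ENNReal.one_ne_top) h hlt).ne (h1.trans h2.symm)
  by_cases h : ∀ i, π i ≤ π' i
  · exact (hdom π π' hπ.sum_eq_one hπ'.sum_eq_one h).symm
  by_cases h' : ∀ i, π' i ≤ π i
  · exact hdom π' π hπ'.sum_eq_one hπ.sum_eq_one h'
  push Not at h h'
  obtain ⟨a, ha⟩ := h
  obtain ⟨b, hb⟩ := h'
  have h1 := ne_zero_of_invariant (hdiff π hπ.stationary fun i => min_le_left _ _) hirr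
    (i := a) (by simpa [hρ_def, ha.le, tsub_eq_zero_iff_le] using ha) a
  have h2 := ne_zero_of_invariant (hdiff π' hπ'.stationary fun i => min_le_right _ _) hirr
    (i := b) (by simpa [hρ_def, hb.le, tsub_eq_zero_iff_le] using hb) a
  -- At `a` the minimum is `π' a`, so the second difference vanishes there.
  exact (h2 (by simp [hρ_def, ha.le])).elim

end Chain

/-! ### Irreducible 0-1 matrices -/

section Matrix

variable {I : Type*} {M : Matrix I I ℤ}

theorem Matrix.IsIrreducible.reflTransGen (hirr : M.IsIrreducible) (i j : I) :
    Relation.ReflTransGen (fun a b => 0 < M a b) i j := by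
  let _ : Quiver I := M.toQuiver
  obtain ⟨p, -⟩ := hirr.connected i j
  induction p with
  | nil => exact .refl
  | cons _ e ih => exact ih.tail e.down

theorem Matrix.IsIrreducible.exists_col_pos (hirr : M.IsIrreducible) (j : I) :
    ∃ i, 0 < M i j := by
  let _ : Quiver I := M.toQuiver
  obtain ⟨p, hp⟩ := hirr.connected j j
  cases p with
  | nil => simp at hp
  | @cons b _ _ e => exact ⟨b, e.down⟩

theorem columnSum_eq_encard (hM : ∀ i j, M i j = 0 ∨ M i j = 1) (j : I) :
    columnSum M j = ({i | M i j = 1}.encard : ℝ≥0∞) := by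
  rw [← ENNReal.tsum_set_one, columnSum]
  refine Eq.trans ?_ (tsum_subtype {i | M i j = 1} fun _ => (1 : ℝ≥0∞)).symm
  refine tsum_congr fun i => ?_
  rcases hM i j with h | h <;> simp [h]

theorem backwardMatrix_eq_inv {i j : I} (h : M i j = 1) :
    backwardMatrix M j i = (columnSum M j)⁻¹ := by
  simp [backwardMatrix, h]

theorem backwardMatrix_eq_zero (hM : ∀ i j, M i j = 0 ∨ M i j = 1) {i j : I} (h : M i j ≠ 1) :
    backwardMatrix M j i = 0 := by
  simp [backwardMatrix, (hM i j).resolve_right h]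

theorem tsum_backwardMatrix (hM : ∀ i j, M i j = 0 ∨ M i j = 1) (hirr : M.IsIrreducible)
    (hc : ∀ j, columnSum M j < ∞) (j : I) : ∑' i, backwardMatrix M j i = 1 := by
  have h0 : columnSum M j ≠ 0 := by
    obtain ⟨i, hi⟩ := hirr.exists_col_pos j
    intro h
    have := ENNReal.tsum_eq_zero.1 h i
    rw [(hM i j).resolve_left hi.ne'] at this
    simp at this
  simp_rw [backwardMatrix, div_eq_mul_inv]
  rw [ENNReal.tsum_mul_right]
  exact ENNReal.mul_inv_cancel h0 (hc j).ne

theorem backwardMatrix_reflTransGen (hM : ∀ i j, M i j = 0 ∨ M i j = 1)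
    (hirr : M.IsIrreducible) (hc : ∀ j, columnSum M j < ∞) (i k : I) :
    Relation.ReflTransGen (fun a b => backwardMatrix M a b ≠ 0) i k := by
  have h := Relation.reflTransGen_swap.2 (hirr.reflTransGen k i)
  refine h.lift id fun a b hab => ?_
  have hab' : 0 < M b a := hab
  refine ne_of_eq_of_ne (backwardMatrix_eq_inv ((hM b a).resolve_left hab'.ne')) ?_
  exact ENNReal.inv_ne_zero.2 (hc a).ne

end Matrix

/-! ### The shift space -/

/-- The sequence `i, w 0, w 1, …`. -/
def consSeq {I : Type*} (i : I) (w : ℕ → I) : ℕ → I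
  | 0 => i
  | n + 1 => w n

section Shift

variable {I : Type*} {M : Matrix I I ℤ}

theorem image_cylinderPartition (i : I) :
    shiftMap M '' cylinderPartition M i = {x | M i (x.1 0) = 1} := by
  ext x
  constructor
  · rintro ⟨y, hy, rfl⟩
    have := y.2 0
    rwa [show y.1 0 = i from hy] at this
  · intro hx
    refine ⟨⟨consSeq i x.1, ?_⟩, rfl, rfl⟩
    rintro (_ | n)
    · exact hx
    · exact x.2 n

theorem cylinderSet_succ (n : ℕ) (w : ℕ → I) :
    cylinderSet M (n + 1) w
      = cylinderPartition M (w 0) ∩ shiftMap M ⁻¹' cylinderSet M n fun k => w (k + 1) := by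
  ext x
  constructor
  · exact fun hx => ⟨hx 0 (Nat.zero_le _), fun k hk => hx (k + 1) (Nat.succ_le_succ hk)⟩
  · rintro ⟨h0, h⟩ (_ | k) hk
    · exact h0
    · exact h k (Nat.le_of_succ_le_succ hk)

theorem cylinderSet_zero (w : ℕ → I) : cylinderSet M 0 w = cylinderPartition M (w 0) := by
  ext x
  simp [cylinderSet, cylinderPartition]

theorem cylinderSet_subset_cylinderPartition (n : ℕ) (w : ℕ → I) :
    cylinderSet M n w ⊆ cylinderPartition M (w 0) :=
  fun _ hx => hx 0 (Nat.zero_le n)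

theorem isPiSystem_cylinderSet :
    IsPiSystem {s | ∃ n w, s = cylinderSet M n w} := by
  rintro _ ⟨n, v, rfl⟩ _ ⟨m, w, rfl⟩ ⟨x, hxv, hxw⟩
  refine ⟨max n m, x.1, ?_⟩
  ext y
  constructor
  · rintro ⟨hv, hw⟩ k hk
    rcases le_max_iff.1 hk with h | h
    · rw [hv k h, hxv k h]
    · rw [hw k h, hxw k h]
  · exact fun hy => ⟨fun k hk => (hy k (hk.trans (le_max_left _ _))).trans (hxv k hk),
      fun k hk => (hy k (hk.trans (le_max_right _ _))).trans (hxw k hk)⟩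

theorem disjoint_cylinderPartition :
    Pairwise (Function.onFun Disjoint (cylinderPartition M)) := fun _ _ hij =>
  Set.disjoint_left.2 fun _ hi hj => hij (Eq.trans (Eq.symm hi) hj)

/-- A nonempty set of points with the same initial symbol `j` is subordinate to the images of the
cylinders; its branches are the predecessors of `j`. -/
theorem branches_eq {B : Set (markovShift M)} {j : I} (hB : B ⊆ cylinderPartition M j)
    (hne : B.Nonempty) :
    SubordinateToImages (shiftMap M) (cylinderPartition M) B ∧
      branches (shiftMap M) (cylinderPartition M) B = {i | M i j = 1} := by
  have hiff : ∀ x ∈ B, ∀ i, x ∈ shiftMap M '' cylinderPartition M i ↔ M i j = 1 := by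
    intro x hx i
    rw [image_cylinderPartition, Set.mem_ofPred_eq, show x.1 0 = j from hB hx]
  refine ⟨fun i => ?_, ?_⟩
  · by_cases h : M i j = 1
    · exact .inl fun x hx => (hiff x hx i).2 h
    · exact .inr fun x hx hx' => h ((hiff x hx i).1 hx')
  · ext i
    obtain ⟨x, hx⟩ := hne
    exact ⟨fun h => (hiff x hx i).1 (h hx), fun h y hy => (hiff y hy i).2 h⟩

end Shift

/-! ### Measures on the shift space -/

section Measurable

variable {I : Type*} [MeasurableSpace I] {M : Matrix I I ℤ}

theorem measurable_coordinate (n : ℕ) : Measurable fun x : markovShift M => x.1 n :=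
  (measurable_pi_apply n).comp measurable_subtype_coe

theorem measurable_shiftMap : Measurable (shiftMap M) :=
  (measurable_pi_lambda _ fun n => measurable_coordinate (n + 1)).subtype_mk

variable [DiscreteMeasurableSpace I]

theorem measurableSet_cylinderPartition (i : I) : MeasurableSet (cylinderPartition M i) :=
  measurable_coordinate 0 (MeasurableSet.singleton i)

theorem measurableSet_cylinderSet (n : ℕ) (w : ℕ → I) : MeasurableSet (cylinderSet M n w) := by
  induction n generalizing w with
  | zero => exact cylinderSet_zero (M := M) w ▸ measurableSet_cylinderPartition _
  | succ n ih =>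
    rw [cylinderSet_succ]
    exact (measurableSet_cylinderPartition _).inter (measurable_shiftMap (ih _))

variable [Countable I]

theorem measure_eq_tsum_cylinderPartition (μ : Measure (markovShift M))
    {B : Set (markovShift M)} (hB : MeasurableSet B) :
    μ B = ∑' i, μ (cylinderPartition M i ∩ B) := by
  rw [← measure_iUnion (fun i j hij => (disjoint_cylinderPartition hij).mono
      Set.inter_subset_left Set.inter_subset_left)
    fun i => (measurableSet_cylinderPartition i).inter hB, ← Set.iUnion_inter,
    Set.iUnion_eq_univ_iff.2 fun x => ⟨x.1 0, rfl⟩, Set.univ_inter]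

theorem generateFrom_cylinderSet :
    (inferInstance : MeasurableSpace (markovShift M))
      = MeasurableSpace.generateFrom {s | ∃ n w, s = cylinderSet M n w} := by
  refine le_antisymm ?_ (MeasurableSpace.generateFrom_le ?_)
  · let m := MeasurableSpace.generateFrom {s | ∃ n w, s = cylinderSet M n w}
    -- The initial words of a given length form a countable set, and their fibres are cylinders.
    have hprefix : ∀ n : ℕ,
        @Measurable _ _ m _ fun (x : markovShift M) (k : Fin (n + 1)) => x.1 k := by
      intro n
      refine @measurable_to_countable' _ _ _ _ m _ fun v => ?_
      refine MeasurableSpace.measurableSet_generateFrom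
        ⟨n, fun k => v ⟨min k n, by omega⟩, ?_⟩
      ext x
      constructor
      · rintro rfl k hk
        simp [hk]
      · intro hx
        funext k
        have := hx k (Nat.le_of_lt_succ k.2)
        simpa [Nat.le_of_lt_succ k.2] using this
    refine Measurable.comap_le (@measurable_pi_lambda _ _ _ m _ _ fun n => ?_)
    exact (measurable_pi_apply (Fin.last n)).comp (hprefix n)
  · rintro _ ⟨n, w, rfl⟩
    exact measurableSet_cylinderSet n w

theorem measure_ext_of_cylinderSet {μ ν : Measure (markovShift M)} [IsFiniteMeasure μ]
    (h : ∀ n w, μ (cylinderSet M n w) = ν (cylinderSet M n w)) : μ = ν := by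
  refine ext_of_generate_finite _ generateFrom_cylinderSet isPiSystem_cylinderSet ?_ ?_
  · rintro _ ⟨n, w, rfl⟩
    exact h n w
  · rw [measure_eq_tsum_cylinderPartition μ .univ, measure_eq_tsum_cylinderPartition ν .univ]
    refine tsum_congr fun i => ?_
    simpa [cylinderSet_zero] using h 0 fun _ => i

end Measurable

/-! ### Fair measures and backward transitions -/

section Fair

variable {I : Type*} [MeasurableSpace I] {M : Matrix I I ℤ}

/-- The backward transition probabilities of `μ` are given by `Q`: conditionally on `σ x`, the
initial symbol of `x` is `i` with probability `Q j i`, where `j` is the initial symbol of `σ x`. -/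
def HasBackwardTransitions (Q : Matrix I I ℝ≥0∞) (μ : Measure (markovShift M)) : Prop :=
  ∀ i, ∀ B : Set (markovShift M), MeasurableSet B →
    μ (cylinderPartition M i ∩ shiftMap M ⁻¹' B)
      = ∑' j, Q j i * μ (cylinderPartition M j ∩ B)

/-- Backward transitions survive conditioning on a set that is invariant under the shift. -/
theorem HasBackwardTransitions.cond {Q : Matrix I I ℝ≥0∞} {μ : Measure (markovShift M)}
    (hμ : HasBackwardTransitions Q μ) {A : Set (markovShift M)} (hA : MeasurableSet A)
    (hinv : shiftMap M ⁻¹' A = A) :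
    HasBackwardTransitions Q (ProbabilityTheory.cond μ A) := by
  intro i B hB
  have h := hμ i (A ∩ B) (hA.inter hB)
  rw [Set.preimage_inter, hinv] at h
  simp_rw [ProbabilityTheory.cond_apply hA]
  rw [Set.inter_left_comm, h, ← ENNReal.tsum_mul_left]
  exact tsum_congr fun j => by rw [Set.inter_left_comm, mul_left_comm]

/-- If there is only one probability measure with given backward transitions, it is ergodic: it
agrees with its conditional measure on every invariant set of positive measure. -/
theorem HasBackwardTransitions.preErgodic {Q : Matrix I I ℝ≥0∞} {μ : Measure (markovShift M)}
    [IsProbabilityMeasure μ] (hμ : HasBackwardTransitions Q μ)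
    (huniq : ∀ ν : Measure (markovShift M), IsProbabilityMeasure ν →
      HasBackwardTransitions Q ν → ν = μ) :
    PreErgodic (shiftMap M) μ where
  aeconst_set A hA hinv := by
    rw [Filter.eventuallyConst_set]
    by_cases h0 : μ A = 0
    · exact .inr (measure_eq_zero_iff_ae_notMem.1 h0)
    · left
      have hcond := huniq _ (ProbabilityTheory.cond_isProbabilityMeasure h0) (hμ.cond hA hinv)
      have h1 := ProbabilityTheory.cond_apply_self h0 (measure_ne_top μ A)
      rw [hcond] at h1
      exact (mem_ae_iff_prob_eq_one hA).2 h1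

variable [DiscreteMeasurableSpace I]

theorem HasBackwardTransitions.measure_cylinderSet {Q : Matrix I I ℝ≥0∞}
    {μ : Measure (markovShift M)} (hμ : HasBackwardTransitions Q μ) (n : ℕ) (w : ℕ → I) :
    μ (cylinderSet M n w)
      = μ (cylinderPartition M (w n)) * ∏ k ∈ Finset.range n, Q (w (k + 1)) (w k) := by
  induction n generalizing w with
  | zero => simp [cylinderSet_zero]
  | succ n ih =>
    rw [cylinderSet_succ, hμ _ _ (measurableSet_cylinderSet n _), tsum_eq_single (w 1),
      Set.inter_eq_right.2 (cylinderSet_subset_cylinderPartition n fun k => w (k + 1)), ih,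
      Finset.prod_range_succ']
    · ring
    · intro j hj
      have hempty : cylinderPartition M j ∩ cylinderSet M n (fun k => w (k + 1)) = ∅ :=
        Set.disjoint_iff_inter_eq_empty.1 ((disjoint_cylinderPartition hj).mono_right
          (cylinderSet_subset_cylinderPartition n _))
      rw [hempty, measure_empty, mul_zero]

variable [Countable I]

theorem IsFair.hasBackwardTransitions (hM : ∀ i j, M i j = 0 ∨ M i j = 1)
    {μ : Measure (markovShift M)} (hμ : IsFair (shiftMap M) (cylinderPartition M) μ) :
    HasBackwardTransitions (backwardMatrix M) μ := by
  -- It suffices to treat the parts of `B` in the cylinders of length one.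
  have key : ∀ i j, ∀ B : Set (markovShift M), MeasurableSet B → B ⊆ cylinderPartition M j →
      μ (cylinderPartition M i ∩ shiftMap M ⁻¹' B) = backwardMatrix M j i * μ B := by
    intro i j B hB hBj
    rcases B.eq_empty_or_nonempty with rfl | hne
    · simp
    obtain ⟨hsub, hbr⟩ := branches_eq hBj hne
    by_cases hij : M i j = 1
    · rw [hμ.fair B hB hsub i (hbr ▸ hij), hbr, ← columnSum_eq_encard hM,
        backwardMatrix_eq_inv hij, div_eq_mul_inv, mul_comm]
    · rw [backwardMatrix_eq_zero hM hij, zero_mul]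
      have hempty : cylinderPartition M i ∩ shiftMap M ⁻¹' B = ∅ := by
        refine Set.eq_empty_of_forall_notMem fun x hx => hij ?_
        have h := x.2 0
        rwa [show x.1 0 = i from hx.1, show x.1 (0 + 1) = j from hBj hx.2] at h
      rw [hempty, measure_empty]
  intro i B hB
  have hBj : ∀ j, MeasurableSet (cylinderPartition M j ∩ B) :=
    fun j => (measurableSet_cylinderPartition j).inter hB
  rw [← tsum_congr fun j => key i j _ (hBj j) Set.inter_subset_left, ← measure_iUnion,
    ← Set.inter_iUnion, ← Set.preimage_iUnion, ← Set.iUnion_inter,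
    Set.iUnion_eq_univ_iff.2 fun x => ⟨x.1 0, rfl⟩, Set.univ_inter]
  · intro j k hjk
    exact (((disjoint_cylinderPartition hjk).mono Set.inter_subset_left
      Set.inter_subset_left).preimage _).mono Set.inter_subset_right Set.inter_subset_right
  · exact fun j => (measurableSet_cylinderPartition i).inter (measurable_shiftMap (hBj j))

theorem HasBackwardTransitions.isFair (hM : ∀ i j, M i j = 0 ∨ M i j = 1)
    (hirr : M.IsIrreducible) (hc : ∀ j, columnSum M j < ∞)
    {μ : Measure (markovShift M)} [IsProbabilityMeasure μ]
    (hμ : HasBackwardTransitions (backwardMatrix M) μ) :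
    IsFair (shiftMap M) (cylinderPartition M) μ where
  isProbabilityMeasure := inferInstance
  measurePreserving := by
    refine ⟨measurable_shiftMap, Measure.ext fun B hB => ?_⟩
    rw [Measure.map_apply measurable_shiftMap hB,
      measure_eq_tsum_cylinderPartition μ (measurable_shiftMap hB),
      tsum_congr fun i => hμ i B hB, ENNReal.tsum_comm, measure_eq_tsum_cylinderPartition μ hB]
    exact tsum_congr fun j => by
      rw [ENNReal.tsum_mul_right, tsum_backwardMatrix hM hirr hc, one_mul]
  fair B hB hsub i hi := by
    rw [hμ i B hB, measure_eq_tsum_cylinderPartition μ hB, div_eq_mul_inv,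
      ← ENNReal.tsum_mul_right]
    refine tsum_congr fun j => ?_
    rcases (cylinderPartition M j ∩ B).eq_empty_or_nonempty with h | h
    · simp [h]
    -- All points of `B` lie in the same images, so `B` has the branches of `[j] ∩ B`.
    have hbr : branches (shiftMap M) (cylinderPartition M) B = {i | M i j = 1} := by
      rw [← (branches_eq Set.inter_subset_left h).2]
      obtain ⟨x, hx⟩ := h
      ext k
      exact ⟨fun hk => Set.inter_subset_right.trans hk,
        fun hk => (hsub k).resolve_right fun hk' => hk' hx.2 (hk hx)⟩
    rw [hbr] at hi
    rw [hbr, ← columnSum_eq_encard hM, backwardMatrix_eq_inv hi, mul_comm]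

theorem HasBackwardTransitions.isStationaryDistribution {Q : Matrix I I ℝ≥0∞}
    {μ : Measure (markovShift M)} [IsProbabilityMeasure μ] (hμ : HasBackwardTransitions Q μ) :
    IsStationaryDistribution Q fun i => μ (cylinderPartition M i) where
  sum_eq_one := by
    have h := measure_eq_tsum_cylinderPartition μ .univ
    simpa using h.symm
  stationary i := by
    have h := hμ i .univ .univ
    simp only [Set.preimage_univ, Set.inter_univ] at h
    rw [h]
    exact tsum_congr fun j => mul_comm _ _

theorem HasBackwardTransitions.ext {Q : Matrix I I ℝ≥0∞} {μ ν : Measure (markovShift M)}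
    [IsFiniteMeasure μ] (hμ : HasBackwardTransitions Q μ) (hν : HasBackwardTransitions Q ν)
    (h : ∀ i, μ (cylinderPartition M i) = ν (cylinderPartition M i)) : μ = ν :=
  measure_ext_of_cylinderSet fun n w => by
    rw [hμ.measure_cylinderSet, hν.measure_cylinderSet, h]

end Fair

/-! ### Existence of Markov measures -/

section Existence

open ProbabilityTheory ProbabilityTheory.Kernel

variable {I : Type*} [MeasurableSpace I]

/-- The state at time `n` of a path up to time `n`. -/
def lastState (n : ℕ) (y : Finset.Iic n → I) : I :=
  y ⟨n, Finset.mem_Iic.2 le_rfl⟩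

theorem measurable_lastState (n : ℕ) : Measurable (lastState n : (Finset.Iic n → I) → I) :=
  measurable_pi_apply _

variable [DiscreteMeasurableSpace I] [Countable I]

/-- The probability measure on a discrete space with given weights. -/
noncomputable def weightMeasure (p : I → ℝ≥0∞) (hp : ∑' i, p i = 1) : Measure I :=
  PMF.toMeasure ⟨p, ENNReal.summable.hasSum_iff.2 hp⟩

instance (p : I → ℝ≥0∞) (hp : ∑' i, p i = 1) : IsProbabilityMeasure (weightMeasure p hp) :=
  PMF.toMeasure.isProbabilityMeasure _

theorem weightMeasure_singleton (p : I → ℝ≥0∞) (hp : ∑' i, p i = 1) (i : I) :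
    weightMeasure p hp {i} = p i :=
  PMF.toMeasure_apply_singleton _ i (MeasurableSet.singleton i)

/-- The kernel that draws the next state of a Markov chain with transition matrix `P` from its
past up to time `n`. -/
noncomputable def chainKernel (P : Matrix I I ℝ≥0∞) (hP : ∀ i, ∑' j, P i j = 1) (n : ℕ) :
    Kernel (Finset.Iic n → I) I :=
  (Kernel.ofFunOfCountable fun i => weightMeasure (P i) (hP i)).comap
    (lastState n) (measurable_lastState n)

instance (P : Matrix I I ℝ≥0∞) (hP : ∀ i, ∑' j, P i j = 1) (n : ℕ) :
    IsMarkovKernel (chainKernel P hP n) where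
  isProbabilityMeasure y :=
    inferInstanceAs (IsProbabilityMeasure (weightMeasure (P (lastState n y)) (hP (lastState n y))))

theorem chainKernel_singleton (P : Matrix I I ℝ≥0∞) (hP : ∀ i, ∑' j, P i j = 1) (n : ℕ)
    (y : Finset.Iic n → I) (j : I) :
    chainKernel P hP n y {j} = P (lastState n y) j :=
  weightMeasure_singleton _ (hP _) j

/-- The distribution on sequences of a Markov chain with initial distribution `π` and transition
matrix `P`. -/
noncomputable def chainMeasure (π : I → ℝ≥0∞) (hπ : ∑' i, π i = 1) (P : Matrix I I ℝ≥0∞)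
    (hP : ∀ i, ∑' j, P i j = 1) : Measure (ℕ → I) :=
  trajMeasure (X := fun _ => I) (weightMeasure π hπ) (chainKernel P hP)

variable (π : I → ℝ≥0∞) (hπ : ∑' i, π i = 1) (P : Matrix I I ℝ≥0∞) (hP : ∀ i, ∑' j, P i j = 1)

instance : IsProbabilityMeasure (chainMeasure π hπ P hP) :=
  inferInstanceAs (IsProbabilityMeasure
    (trajMeasure (X := fun _ => I) (weightMeasure π hπ) (chainKernel P hP)))

theorem chainMeasure_zero (i : I) : chainMeasure π hπ P hP {x | x 0 = i} = π i := by
  have hmap : (chainMeasure π hπ P hP).map (Preorder.frestrictLe 0)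
      = (weightMeasure π hπ).map
        (MeasurableEquiv.piUnique fun _ : Finset.Iic 0 => I).symm := by
    rw [chainMeasure, trajMeasure, Measure.map_comp _ _ (by fun_prop), traj_map_frestrictLe,
      partialTraj_self, Measure.id_comp]
  have hs : MeasurableSet (lastState 0 ⁻¹' {i}) :=
    measurable_lastState 0 (MeasurableSet.singleton i)
  have h := DFunLike.congr_fun hmap (lastState 0 ⁻¹' {i})
  rw [Measure.map_apply (by fun_prop) hs, Measure.map_apply (by fun_prop) hs] at h
  exact h.trans (weightMeasure_singleton π hπ i)

/-- The Markov property: given any event up to time `n` on which the chain is at `i` at time `n`,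
it moves to `j` with probability `P i j`. -/
theorem chainMeasure_inter (n : ℕ) (i j : I) {s : Set (Finset.Iic n → I)}
    (hs : MeasurableSet s) (hsi : ∀ y ∈ s, lastState n y = i) :
    chainMeasure π hπ P hP (Preorder.frestrictLe n ⁻¹' s ∩ {x | x (n + 1) = j})
      = chainMeasure π hπ P hP (Preorder.frestrictLe n ⁻¹' s) * P i j := by
  have h := DFunLike.congr_fun
    (map_frestrictLe_trajMeasure_compProd_eq_map_trajMeasure (X := fun _ => I)
      (μ₀ := weightMeasure π hπ) (κ := chainKernel P hP) (a := n)) (s ×ˢ {j})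
  rw [Measure.compProd_apply_prod hs (MeasurableSet.singleton j),
    setLIntegral_congr_fun hs (g := fun _ => P i j)
      fun y hy => by rw [chainKernel_singleton, hsi y hy],
    MeasureTheory.setLIntegral_const, Measure.map_apply (by fun_prop) hs,
    Measure.map_apply (by fun_prop) (hs.prod (MeasurableSet.singleton j))] at h
  rw [mul_comm]
  exact h.symm

theorem chainMeasure_cylinder (n : ℕ) (w : ℕ → I) :
    chainMeasure π hπ P hP {x | ∀ k ≤ n, x k = w k}
      = π (w 0) * ∏ k ∈ Finset.range n, P (w k) (w (k + 1)) := by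
  induction n with
  | zero => simpa using chainMeasure_zero π hπ P hP (w 0)
  | succ n ih =>
    have hpre : ∀ m : ℕ, {x : ℕ → I | ∀ k ≤ m, x k = w k}
        = Preorder.frestrictLe (π := fun _ => I) m ⁻¹' {fun k : Finset.Iic m => w k} := by
      intro m
      ext x
      simp [funext_iff]
    have hsucc : {x : ℕ → I | ∀ k ≤ n + 1, x k = w k}
        = {x | ∀ k ≤ n, x k = w k} ∩ {x | x (n + 1) = w (n + 1)} := by
      ext x
      simp [Nat.le_succ_iff, or_imp, forall_and]
    rw [hsucc, hpre, chainMeasure_inter π hπ P hP n (w n) _ (MeasurableSet.singleton _)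
      (by rintro y rfl; rfl), ← hpre, ih, Finset.prod_range_succ, mul_assoc]

variable {M : Matrix I I ℤ}

theorem measurableSet_markovShift : MeasurableSet (markovShift M) := by
  have h : markovShift M = ⋂ n : ℕ, {x | M (x n) (x (n + 1)) = 1} := by
    ext x
    simp [markovShift]
  rw [h]
  refine MeasurableSet.iInter fun n => ?_
  have hpair : Measurable fun x : ℕ → I => (x n, x (n + 1)) := by fun_prop
  exact hpair (MeasurableSet.of_discrete (s := {p : I × I | M p.1 p.2 = 1}))

theorem ae_mem_markovShift (hPM : ∀ i j, M i j ≠ 1 → P i j = 0) :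
    ∀ᵐ x ∂chainMeasure π hπ P hP, x ∈ markovShift M := by
  refine ae_all_iff.2 fun n => ?_
  have hnull : ∀ i j, M i j ≠ 1 →
      ∀ᵐ x ∂chainMeasure π hπ P hP, ¬ (x n = i ∧ x (n + 1) = j) := by
    intro i j hij
    have h := chainMeasure_inter π hπ P hP n i j (s := lastState n ⁻¹' {i})
      (measurable_lastState n (MeasurableSet.singleton i)) fun y hy => hy
    rw [hPM i j hij, mul_zero] at h
    exact measure_eq_zero_iff_ae_notMem.1 h
  have hall : ∀ᵐ x ∂chainMeasure π hπ P hP,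
      ∀ i j, M i j ≠ 1 → ¬ (x n = i ∧ x (n + 1) = j) := by
    refine ae_all_iff.2 fun i => ae_all_iff.2 fun j => ?_
    by_cases hij : M i j = 1
    · exact .of_forall fun x h => (h hij).elim
    · filter_upwards [hnull i j hij] with x hx _ using hx
  filter_upwards [hall] with x hx
  by_contra h
  exact hx _ _ h ⟨rfl, rfl⟩

theorem exists_isMarkovMeasure (hπ : ∑' i, π i = 1) (hP : ∀ i, ∑' j, P i j = 1)
    (hPM : ∀ i j, M i j ≠ 1 → P i j = 0) :
    ∃ μ : Measure (markovShift M), IsMarkovMeasure M π P μ := by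
  have hmem := ae_mem_markovShift π hπ P hP hPM
  have hval : ∀ s : Set (ℕ → I),
      (chainMeasure π hπ P hP).comap Subtype.val (Subtype.val ⁻¹' s : Set (markovShift M))
        = chainMeasure π hπ P hP s := by
    intro s
    rw [(MeasurableEmbedding.subtype_coe measurableSet_markovShift).comap_apply,
      Subtype.image_preimage_coe]
    refine measure_congr ?_
    filter_upwards [hmem] with x hx
    exact propext ⟨fun h => h.2, fun h => ⟨hx, h⟩⟩
  exact ⟨(chainMeasure π hπ P hP).comap Subtype.val, hπ, hP, ⟨(hval .univ).trans measure_univ⟩,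
    fun n w => (hval _).trans (chainMeasure_cylinder π hπ P hP n w)⟩

end Existence

/-! ### The time reversal of the backward chain -/

section Reversal

variable {I : Type*} {Q : Matrix I I ℝ≥0∞} {π : I → ℝ≥0∞}

theorem IsStationaryDistribution.mul_timeReversal (hπ : IsStationaryDistribution Q π)
    (h0 : ∀ i, π i ≠ 0) (i j : I) : π i * timeReversal Q π i j = π j * Q j i :=
  ENNReal.mul_div_cancel (h0 i) (hπ.ne_top i)

theorem IsStationaryDistribution.tsum_timeReversal (hπ : IsStationaryDistribution Q π)
    (h0 : ∀ i, π i ≠ 0) (i : I) : ∑' j, timeReversal Q π i j = 1 := by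
  simp_rw [timeReversal, div_eq_mul_inv]
  rw [ENNReal.tsum_mul_right, hπ.stationary, ENNReal.mul_inv_cancel (h0 i) (hπ.ne_top i)]

theorem IsStationaryDistribution.mul_prod_timeReversal (hπ : IsStationaryDistribution Q π)
    (h0 : ∀ i, π i ≠ 0) (n : ℕ) (w : ℕ → I) :
    π (w 0) * ∏ k ∈ Finset.range n, timeReversal Q π (w k) (w (k + 1))
      = π (w n) * ∏ k ∈ Finset.range n, Q (w (k + 1)) (w k) := by
  induction n with
  | zero => simp
  | succ n ih =>
    rw [Finset.prod_range_succ, Finset.prod_range_succ, ← mul_assoc, ih, mul_right_comm,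
      hπ.mul_timeReversal h0]
    ring

variable [MeasurableSpace I] {M : Matrix I I ℤ}

theorem IsMarkovMeasure.measure_cylinderPartition {P : Matrix I I ℝ≥0∞}
    {μ : Measure (markovShift M)} (hμ : IsMarkovMeasure M π P μ) (i : I) :
    μ (cylinderPartition M i) = π i := by
  simpa [cylinderSet_zero] using hμ.cylinder 0 fun _ => i

variable [DiscreteMeasurableSpace I] [Countable I]

theorem IsMarkovMeasure.hasBackwardTransitions {μ : Measure (markovShift M)}
    (hπ : IsStationaryDistribution Q π) (h0 : ∀ i, π i ≠ 0)
    (hμ : IsMarkovMeasure M π (timeReversal Q π) μ) : HasBackwardTransitions Q μ := by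
  have := hμ.isProbabilityMeasure
  intro i B hB
  have hmeas := measurable_shiftMap (M := M)
  -- Both sides are finite measures in `B`, so it suffices to compare them on cylinders.
  have hext : (μ.restrict (cylinderPartition M i)).map (shiftMap M)
      = Measure.sum fun j => Q j i • μ.restrict (cylinderPartition M j) := by
    refine measure_ext_of_cylinderSet fun n w => ?_
    have hcyl := measurableSet_cylinderSet (M := M) n w
    rw [Measure.map_apply hmeas hcyl, Measure.restrict_apply (hmeas hcyl),
      Measure.sum_apply _ hcyl, tsum_eq_single (w 0)]
    · have hcons : shiftMap M ⁻¹' cylinderSet M n w ∩ cylinderPartition M i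
          = cylinderSet M (n + 1) (consSeq i w) := by
        rw [cylinderSet_succ, Set.inter_comm]
        rfl
      rw [hcons, hμ.cylinder, hπ.mul_prod_timeReversal h0, Measure.smul_apply,
        Measure.restrict_apply hcyl,
        Set.inter_eq_left.2 (cylinderSet_subset_cylinderPartition n w), hμ.cylinder,
        hπ.mul_prod_timeReversal h0, Finset.prod_range_succ', smul_eq_mul]
      simp only [consSeq]
      ring
    · intro j hj
      have hempty : cylinderSet M n w ∩ cylinderPartition M j = ∅ :=
        Set.disjoint_iff_inter_eq_empty.1 ((disjoint_cylinderPartition hj.symm).mono_left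
          (cylinderSet_subset_cylinderPartition n w))
      rw [Measure.smul_apply, Measure.restrict_apply hcyl, hempty, measure_empty, smul_zero]
  have h := DFunLike.congr_fun hext B
  rw [Measure.map_apply hmeas hB, Measure.restrict_apply (hmeas hB),
    Measure.sum_apply _ hB, Set.inter_comm] at h
  rw [h]
  exact tsum_congr fun j => by
    rw [Measure.smul_apply, Measure.restrict_apply hB, Set.inter_comm, smul_eq_mul]

end Reversal

/-! ### Fair measures on Markov shifts -/

theorem mainTheorem3 {I : Type*} [Countable I] [Nonempty I] [MeasurableSpace I]
    [DiscreteMeasurableSpace I] (M : Matrix I I ℤ) (hM : ∀ i j, M i j = 0 ∨ M i j = 1)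
    (hirr : M.IsIrreducible) (hc : ∀ j, columnSum M j < ⊤) :
    (IsPositiveRecurrent (backwardMatrix M) →
      ∃ π : I → ENNReal, IsStationaryDistribution (backwardMatrix M) π ∧
        (∀ π' : I → ENNReal, IsStationaryDistribution (backwardMatrix M) π' → π' = π) ∧
        (∀ i, 0 < π i) ∧
        ∃ μ : MeasureTheory.Measure (markovShift M),
          IsMarkovMeasure M π (timeReversal (backwardMatrix M) π) μ ∧
          Ergodic (shiftMap M) μ ∧
          ∀ ν : MeasureTheory.Measure (markovShift M),
            IsFair (shiftMap M) (cylinderPartition M) ν ↔ ν = μ) ∧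
    (IsNullRecurrent (backwardMatrix M) →
      ¬ ∃ ν : MeasureTheory.Measure (markovShift M),
        IsFair (shiftMap M) (cylinderPartition M) ν) ∧
    (IsTransient (backwardMatrix M) →
      ¬ ∃ ν : MeasureTheory.Measure (markovShift M),
        IsFair (shiftMap M) (cylinderPartition M) ν) := by
  have hQ := tsum_backwardMatrix hM hirr hc
  have hQirr := backwardMatrix_reflTransGen hM hirr hc
  obtain ⟨i₀⟩ := ‹Nonempty I›
  have hrec : ∀ ν : Measure (markovShift M), IsFair (shiftMap M) (cylinderPartition M) ν →
      returnProbability (backwardMatrix M) i₀ = 1 ∧ meanReturnTime (backwardMatrix M) i₀ < ∞ := by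
    intro ν hν
    have := hν.isProbabilityMeasure
    have hst := (hν.hasBackwardTransitions hM).isStationaryDistribution
    exact hst.recurrent hQ (hst.ne_zero hQirr i₀)
  refine ⟨fun hpos => ?_, ?_, ?_⟩
  · obtain ⟨π, hπ⟩ := exists_isStationaryDistribution hQ i₀ (hpos i₀).1 (hpos i₀).2
    have h0 := hπ.ne_zero hQirr
    have huniq : ∀ π', IsStationaryDistribution (backwardMatrix M) π' → π' = π :=
      fun π' hπ' => hπ.unique hQ hQirr hπ'
    obtain ⟨μ, hμ⟩ := exists_isMarkovMeasure (M := M) π (timeReversal (backwardMatrix M) π)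
      hπ.sum_eq_one (hπ.tsum_timeReversal h0) fun i j hij => by
        rw [timeReversal, backwardMatrix_eq_zero hM hij, mul_zero, ENNReal.zero_div]
    have := hμ.isProbabilityMeasure
    have hback := hμ.hasBackwardTransitions hπ h0
    have hμuniq : ∀ ν : Measure (markovShift M), IsProbabilityMeasure ν →
        HasBackwardTransitions (backwardMatrix M) ν → ν = μ := fun ν _ hν =>
      hν.ext hback fun i => (congrFun (huniq _ hν.isStationaryDistribution) i).trans
        (hμ.measure_cylinderPartition i).symm
    have hfair := hback.isFair hM hirr hc
    refine ⟨π, hπ, huniq, fun i => (h0 i).bot_lt, μ, hμ,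
      ⟨hfair.measurePreserving, hback.preErgodic hμuniq⟩, fun ν => ⟨fun hν => ?_, ?_⟩⟩
    · exact hμuniq ν hν.isProbabilityMeasure (hν.hasBackwardTransitions hM)
    · rintro rfl
      exact hfair
  · rintro hnull ⟨ν, hν⟩
    exact (hrec ν hν).2.ne (hnull i₀).2
  · rintro htrans ⟨ν, hν⟩
    exact (htrans i₀).ne (hrec ν hν).1
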